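/- **Setting.** Let $T>0$, let $\nu$ be a Lévy measure on $\mathbb R$ with $\nu(\{0\})=0$ and $\int x^2\,\nu(dx)<\infty$, and write $\mathbb R_0=\mathbb R\setminus\{0\}$. Let $1=\varepsilon_1>\varepsilon_2>\cdots\downarrow 0$ be such that $S_1=\{|x|>\varepsilon_1\}$ and $S_n=\{\varepsilon_n<|x|\le\varepsilon_{n-1}\}$ ($n\ge2$) all have positive $\nu$-measure. Let $(\Omega,\mathcal F,P)=(\Omega_W\times\Omega_N,\mathcal F_W\otimes\mathcal F_N,P_W\otimes P_N)$ be the canonical Lévy space: $\Omega_W=\{\omega'\in C([0,T]):\omega'(0)=0\}$ with Wiener measure $P_W$ and coordinate process $W$; $\Omega_N=\prod_n\bigcup_{k\ge0}([0,T]\times S_n)^k$ with $P_N=\bigotimes_nP^{(n)}$, where, with $\lambda_n=\nu(S_n)$ and $\ell$ Lebesgue measure on $[0,T]$, $P^{(n)}(B)=e^{-\lambda_nT}\sum_k\frac{\lambda_n^k}{k!}\bigl(\ell\otimes\lambda_n^{-1}\nu|_{S_n}\bigr)^{\otimes k}\bigl(B\cap([0,T]\times S_n)^k\bigr)$. Write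 $\omega=(\omega',\omega'')$. Let $N$ be the canonical Poisson random measure on $[0,T]\times\mathbb R_0$, i.e. the counting measure of the points $(t_l,x_l)$ (jump times and jump sizes) of $\omega''$, and $\Delta N(s,y)=N(\{(s,y)\})$. Let $D^W$ be the Malliavin derivative with respect to $W$, i.e. the closure in $L^2$ of the derivative on finite sums of variables $f(\int_0^T h_1dW,\dots,\int_0^T h_ndW)\,G$ with $f\in C_b^\infty(\mathbb R^n)$, $h_j\in L^2([0,T])$, $G\in L^2(\Omega_N)$; let $\mathbb D^W_{1,2},\mathbb D^W_{2,2}$ be the domains of the closures of $D^W$ and of $(D^W,D^{W,2})$, and let $\delta^W$, $\int u_r\,\delta W_r$ (Skorohod integral) be the adjoint of $D^W$. Let $\mathbb D^W_{1,\infty}$ be the set of $F\in\mathbb D^W_{1,2}$ with $\|F\|_{1,\infty}=\|F\|_\infty+\|\,|D^WF|_{L^2([0,T])}\|_\infty<\infty$, and $\mathbb D^W_{2,\infty}$ the set of $F\in\mathbb D^W_{2,2}\cap\mathbb D^W_{1,\infty}$ with $\|F\|_{2,\infty}=\|F\|_{1,\infty}+\|\,|D^{W,2}F|_{L^2([0,T]^2)}\|_\infty<\infty$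 ($\|\cdot\|_\infty$ is the norm of $L^\infty(\Omega)$). **Hypotheses.** The coefficients are measurable in all their variables, and * (H1) $X_0\in\mathbb D^W_{1,\infty}$; $b\in L^1([0,T],\mathbb D^W_{1,\infty})$ and $v_{\cdot-}(y)\in L^1([0,T],\mathbb D^W_{1,\infty})$ for every $y\in\mathbb R_0$; and, for some $p>2$, $a\in L^2([0,T],\mathbb D^W_{2,\infty})\cap L^{2p}([0,T],\mathbb D^W_{1,\infty})$. * (H2) There is a nonnegative $g\in L^1(\mathbb R_0,\nu)\cap L^2(\mathbb R_0,\nu)$ with $|v_{s-}(y,\omega)|\le g(y)$ for all $s\in[0,T]$, $y\in\mathbb R_0$, $\omega\in\Omega$, and $\lim_{y\to0,\,y\ne 0}g(y)=0$. Let $A_{s,t}:\Omega\to\Omega_W$ $(0\le s\le t\le T)$ be the family of absolutely continuous transformations (the law of $A_{s,t}(\cdot,\omega'')$ under $P_W$ is absolutely continuous with respect to $P_W$ for a.e. $\omega''$), measurable in $(s,\omega)$, which solves, for each $t$, almost surely for all $s\in[0,t]$ and $u\in[0,T]$, $$(A_{s,t}\omega)_u=\omega'_u-\int_{s\wedge u}^{t\wedge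 u}a_r(A_{r,t}\omega,\omega'')\,dr ,$$ and let $$L_{0,t}=\exp\Bigl\{\int_0^ta_r(A_{r,t})\,\delta W_r-\tfrac12\int_0^ta_r^2(A_{r,t})\,dr-\int_0^t\!\int_r^t(D^W_ua_r)(A_{r,t})\,D^W_r[a_u(A_{u,t})]\,du\,dr\Bigr\}.$$ Here $F(A_{s,t})$ denotes $\omega\mapsto F(A_{s,t}\omega,\omega'')$. For $\varepsilon>0$ put $$X^\varepsilon_t=X_0(A_{0,t})\,e^{\int_0^tb_s(A_{s,t})ds}\,L_{0,t}\prod_{s\le t,\ |y|>\varepsilon}\bigl[1+v_{s-}(y,A_{s,t})\Delta N(s,y)\bigr]\exp\Bigl\{-\int_0^t\!\int_{\{|y|>\varepsilon\}}v_{s-}(y,A_{s,t})\,\nu(dy)\,ds\Bigr\},$$ $$X_t=X_0(A_{0,t})\,e^{\int_0^tb_s(A_{s,t})ds}\,L_{0,t}\,\exp\Bigl\{-\int_0^t\!\int_{\mathbb R_0}v_{s-}(y,A_{s,t})\,\nu(dy)\,ds\Bigr\}\prod_{s\le t,\ y\in\mathbb R_0}\bigl[1+v_{s-}(y,A_{s,t})\Delta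 N(s,y)\bigr].$$ **Proposition.** Assume (H1) and (H2). Then for each $t\in[0,T]$, almost surely: the integrals $\int_0^tb_s(A_{s,t})ds$ and $\int_0^t\int_{\mathbb R_0}v_{s-}(y,A_{s,t})\,\nu(dy)ds$ converge absolutely, for every $\varepsilon>0$ only finitely many points $(s,y)$ with $s\le t$, $|y|>\varepsilon$ have $\Delta N(s,y)\neq0$, the product over all jumps in $X_t$ converges unconditionally, and $$\lim_{\varepsilon\downarrow0}X^\varepsilon_t=X_t .$$ -/

import Mathlib

open MeasureTheory ProbabilityTheory Filter Topology Set
open scoped ENNReal NNReal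

noncomputable section

namespace LevySDE

/-! ### The canonical Lévy space -/

/-- The shells `{ε₀ < |x|}` and `{ε_{n+1} < |x| ≤ ε_n}` into which the jump sizes are split. -/
def shell (e : ℕ → ℝ) : ℕ → Set ℝ
  | 0 => {x | e 0 < |x|}
  | n + 1 => {x | e (n + 1) < |x| ∧ |x| ≤ e n}

/-- The parameters of the canonical Lévy space: a time horizon `T > 0`, a Lévy measure `ν` with
`ν {0} = 0` and `∫ x² dν < ∞`, and a sequence `1 = ε₀ > ε₁ > ⋯ → 0` all of whose shells are
charged by `ν`. -/
structure LevyData where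
  T : ℝ
  T_pos : 0 < T
  ν : Measure ℝ
  ν_zero : ν {0} = 0
  ν_sq : ∫⁻ x, ENNReal.ofReal (x ^ 2) ∂ν < ∞
  e : ℕ → ℝ
  e_pos : ∀ n, 0 < e n
  e_anti : StrictAnti e
  e_zero : e 0 = 1
  e_tendsto : Tendsto e atTop (𝓝 0)
  shell_pos : ∀ n, 0 < ν (shell e n)

/-- `Ω_W`: continuous functions on `[0,T]` vanishing at `0`. -/
def WienerSpace (𝓛 : LevyData) : Type :=
  {f : C(Icc (0 : ℝ) 𝓛.T, ℝ) // ∀ u : Icc (0 : ℝ) 𝓛.T, (u : ℝ) = 0 → f u = 0}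

/-- The coordinate `W_u(ω) = ω(u)`. -/
def WienerSpace.eval {𝓛 : LevyData} (ω : WienerSpace 𝓛) (u : Icc (0 : ℝ) 𝓛.T) : ℝ := ω.1 u

/-- The σ-algebra generated by the coordinates (it is the Borel σ-algebra of the sup norm). -/
instance (𝓛 : LevyData) : MeasurableSpace (WienerSpace 𝓛) :=
  MeasurableSpace.comap (fun ω u => WienerSpace.eval ω u) MeasurableSpace.pi

/-- Wiener measure: the coordinate process is a centred Gaussian process with covariance
`min s t`. This determines the measure uniquely. -/
structure IsWienerMeasure {𝓛 : LevyData} (PW : Measure (WienerSpace 𝓛)) : Prop where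
  gaussian : IsGaussianProcess (fun u (ω : WienerSpace 𝓛) => ω.eval u) PW
  mean : ∀ u, ∫ ω, ω.eval u ∂PW = 0
  cov : ∀ s u : Icc (0 : ℝ) 𝓛.T,
    cov[fun ω : WienerSpace 𝓛 => ω.eval s, fun ω => ω.eval u; PW] = min (s : ℝ) (u : ℝ)

/-- `Ω⁽ⁿ⁾ = ⋃_k ([0,T] × S_n)^k` (disjoint union), with its natural σ-algebra. -/
abbrev ShellSpace (𝓛 : LevyData) (n : ℕ) : Type :=
  (k : ℕ) × (Fin k → Icc (0 : ℝ) 𝓛.T × shell 𝓛.e n)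

/-- `Q_n = ν(· ∩ S_n) / ν(S_n)`, a measure on `S_n`. -/
def shellLaw (𝓛 : LevyData) (n : ℕ) : Measure (shell 𝓛.e n) :=
  (𝓛.ν (shell 𝓛.e n))⁻¹ • 𝓛.ν.comap Subtype.val

/-- `P⁽ⁿ⁾ = e^{-λ_n T} ∑_k λ_n^k (ℓ ⊗ Q_n)^{⊗k} / k!` with `λ_n = ν(S_n)`. -/
def shellMeasure (𝓛 : LevyData) (n : ℕ) : Measure (ShellSpace 𝓛 n) :=
  Measure.sum fun k : ℕ =>
    (ENNReal.ofReal (Real.exp (-((𝓛.ν (shell 𝓛.e n)).toReal * 𝓛.T)))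
        * (𝓛.ν (shell 𝓛.e n) ^ k / (k.factorial : ℝ≥0∞))) •
      (Measure.pi fun _ : Fin k =>
        ((volume : Measure ℝ).comap (Subtype.val : Icc (0 : ℝ) 𝓛.T → ℝ)).prod (shellLaw 𝓛 n)).map (fun x => (⟨k, x⟩ : ShellSpace 𝓛 n))

/-! Each `P⁽ⁿ⁾` is a probability measure, so that the infinite product below is a genuine one. -/

lemma measurableSet_shell (e : ℕ → ℝ) (n : ℕ) : MeasurableSet (shell e n) := by
  cases n with
  | zero => exact measurableSet_lt measurable_const measurable_norm
  | succ n =>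
    exact (measurableSet_lt measurable_const measurable_norm).inter
      (measurableSet_le measurable_norm measurable_const)

lemma shell_lt_top (𝓛 : LevyData) (n : ℕ) : 𝓛.ν (shell 𝓛.e n) < ∞ := by
  have hsub : shell 𝓛.e n ⊆ {x | ENNReal.ofReal (𝓛.e n ^ 2) ≤ ENNReal.ofReal (x ^ 2)} := by
    intro x hx
    have h : 𝓛.e n < |x| := by
      cases n with
      | zero => exact hx
      | succ n => exact hx.1
    refine ENNReal.ofReal_le_ofReal ?_
    rw [← sq_abs x]
    exact pow_le_pow_left₀ (𝓛.e_pos n).le h.le 2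
  have hpos : ENNReal.ofReal (𝓛.e n ^ 2) ≠ 0 := by
    simpa using pow_pos (𝓛.e_pos n) 2 |>.ne'
  refine (measure_mono hsub).trans_lt ?_
  refine (meas_ge_le_lintegral_div (by fun_prop) hpos ENNReal.ofReal_ne_top).trans_lt ?_
  exact ENNReal.div_lt_top 𝓛.ν_sq.ne hpos

instance (𝓛 : LevyData) (n : ℕ) : IsProbabilityMeasure (shellLaw 𝓛 n) := by
  constructor
  rw [shellLaw, Measure.smul_apply, smul_eq_mul,
    comap_subtype_coe_apply (measurableSet_shell _ n), image_univ, Subtype.range_coe,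
    ENNReal.inv_mul_cancel (𝓛.shell_pos n).ne' (shell_lt_top 𝓛 n).ne]

instance (𝓛 : LevyData) (n : ℕ) : IsProbabilityMeasure (shellMeasure 𝓛 n) := by
  constructor
  have hT : ((volume : Measure ℝ).comap (Subtype.val : Icc (0 : ℝ) 𝓛.T → ℝ)) univ
      = ENNReal.ofReal 𝓛.T := by
    rw [comap_subtype_coe_apply measurableSet_Icc, image_univ, Subtype.range_coe]
    simp
  have : IsFiniteMeasure ((volume : Measure ℝ).comap (Subtype.val : Icc (0 : ℝ) 𝓛.T → ℝ)) :=
    ⟨by rw [hT]; exact ENNReal.ofReal_lt_top⟩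
  have hp : (((volume : Measure ℝ).comap (Subtype.val : Icc (0 : ℝ) 𝓛.T → ℝ)).prod
      (shellLaw 𝓛 n)) univ = ENNReal.ofReal 𝓛.T := by
    rw [← univ_prod_univ, Measure.prod_prod, hT, measure_univ, mul_one]
  have hm (k : ℕ) : Measurable (fun x : Fin k → Icc (0 : ℝ) 𝓛.T × shell 𝓛.e n =>
      (⟨k, x⟩ : ShellSpace 𝓛 n)) :=
    fun s hs => (MeasurableSpace.measurableSet_iInf.1 hs) k
  rw [shellMeasure, Measure.sum_apply _ MeasurableSet.univ]
  set l := (𝓛.ν (shell 𝓛.e n)).toReal with hl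
  have hl0 : 0 ≤ l := ENNReal.toReal_nonneg
  have hlam : 𝓛.ν (shell 𝓛.e n) = ENNReal.ofReal l :=
    (ENNReal.ofReal_toReal (shell_lt_top 𝓛 n).ne).symm
  have hT0 := 𝓛.T_pos.le
  have key (k : ℕ) : ((ENNReal.ofReal (Real.exp (-(l * 𝓛.T)))
        * (𝓛.ν (shell 𝓛.e n) ^ k / (k.factorial : ℝ≥0∞))) •
      (Measure.pi fun _ : Fin k =>
        ((volume : Measure ℝ).comap (Subtype.val : Icc (0 : ℝ) 𝓛.T → ℝ)).prod
          (shellLaw 𝓛 n)).map (fun x => (⟨k, x⟩ : ShellSpace 𝓛 n))) univ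
      = ENNReal.ofReal (Real.exp (-(l * 𝓛.T)) * ((l * 𝓛.T) ^ k / k.factorial)) := by
    rw [Measure.smul_apply, Measure.map_apply (hm k) MeasurableSet.univ, preimage_univ,
      Measure.pi_univ]
    simp only [hp, Finset.prod_const,
      Finset.card_univ, Fintype.card_fin, smul_eq_mul]
    rw [hlam, ENNReal.ofReal_mul (Real.exp_pos _).le, ENNReal.ofReal_div_of_pos (by positivity),
      ENNReal.ofReal_pow (by positivity), ENNReal.ofReal_mul hl0, ENNReal.ofReal_natCast, mul_pow,
      mul_assoc, ENNReal.div_eq_inv_mul, ENNReal.div_eq_inv_mul, mul_assoc]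
  have hs : HasSum (fun k : ℕ => Real.exp (-(l * 𝓛.T)) * ((l * 𝓛.T) ^ k / k.factorial)) 1 := by
    have := (NormedSpace.expSeries_div_hasSum_exp (l * 𝓛.T)).mul_left (Real.exp (-(l * 𝓛.T)))
    rwa [← Real.exp_eq_exp_ℝ, ← Real.exp_add, neg_add_cancel, Real.exp_zero] at this
  simp_rw [key]
  rw [← ENNReal.ofReal_tsum_of_nonneg (fun k => by positivity) hs.summable, hs.tsum_eq,
    ENNReal.ofReal_one]

/-- `Ω_N`. -/
abbrev JumpSpace (𝓛 : LevyData) : Type := (n : ℕ) → ShellSpace 𝓛 n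

/-- `P_N = ⨂_n P⁽ⁿ⁾`. -/
def jumpLaw (𝓛 : LevyData) : Measure (JumpSpace 𝓛) := Measure.infinitePi (shellMeasure 𝓛)

/-- `Ω = Ω_W × Ω_N`. -/
abbrev Space (𝓛 : LevyData) : Type := WienerSpace 𝓛 × JumpSpace 𝓛

/-- `P = P_W ⊗ P_N`. -/
def prob {𝓛 : LevyData} (PW : Measure (WienerSpace 𝓛)) : Measure (Space 𝓛) :=
  PW.prod (jumpLaw 𝓛)

/-- The canonical Poisson random measure `N` on `[0,T] × ℝ₀`: the counting measure of the points
`(t_l, x_l)` (jump times and jump sizes) that constitute `ω`. -/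
def poissonMeasure {𝓛 : LevyData} (ω : JumpSpace 𝓛) : Measure (ℝ × ℝ) :=
  Measure.sum fun n : ℕ => ∑ l : Fin (ω n).1,
    Measure.dirac ((((ω n).2 l).1 : ℝ), (((ω n).2 l).2 : ℝ))

/-- `ΔN(s,y) = N({(s,y)})`. -/
def jumpAt {𝓛 : LevyData} (ω : JumpSpace 𝓛) (s y : ℝ) : ℝ := (poissonMeasure ω {(s, y)}).toReal

/-- Lebesgue measure on `[0,T]`. -/
def leb (𝓛 : LevyData) : Measure ℝ := volume.restrict (Icc 0 𝓛.T)

/-! ### Malliavin derivative and Skorohod integral with respect to `W` -/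

/-- A step function `∑ c_i 1_{(l_i, r_i]}` on `[0,T]`. -/
structure StepFn (𝓛 : LevyData) where
  m : ℕ
  l : Fin m → Icc (0 : ℝ) 𝓛.T
  r : Fin m → Icc (0 : ℝ) 𝓛.T
  le : ∀ i, l i ≤ r i
  c : Fin m → ℝ

def StepFn.val {𝓛 : LevyData} (φ : StepFn 𝓛) (x : ℝ) : ℝ :=
  ∑ i, (Ioc (φ.l i : ℝ) (φ.r i : ℝ)).indicator (fun _ => φ.c i) x

/-- `∫ φ dW = ∑ c_i (W_{r_i} - W_{l_i})`. -/
def StepFn.integral {𝓛 : LevyData} (φ : StepFn 𝓛) (ω : WienerSpace 𝓛) : ℝ :=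
  ∑ i, φ.c i * (ω.eval (φ.r i) - ω.eval (φ.l i))

/-- `I` is a version of the Wiener integral `∫_0^T h dW`, the `L²`-limit of the integrals of step
functions that converge to `h` in `L²([0,T])`. -/
def IsWienerIntegral {𝓛 : LevyData} (PW : Measure (WienerSpace 𝓛)) (h : ℝ → ℝ)
    (I : WienerSpace 𝓛 → ℝ) : Prop :=
  MemLp h 2 (leb 𝓛) ∧ MemLp I 2 PW ∧ ∃ φ : ℕ → StepFn 𝓛,
    Tendsto (fun k => eLpNorm (fun x => (φ k).val x - h x) 2 (leb 𝓛)) atTop (𝓝 0) ∧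
    Tendsto (fun k => eLpNorm (fun ω => (φ k).integral ω - I ω) 2 PW) atTop (𝓝 0)

/-- A random variable `f(∫h_1 dW, …, ∫h_n dW) G` with `h_j ∈ L²([0,T])`, `f ∈ C_b^∞(ℝⁿ)` and
`G ∈ L²(Ω_N)`. -/
structure SmoothTerm {𝓛 : LevyData} (PW : Measure (WienerSpace 𝓛)) where
  n : ℕ
  f : (Fin n → ℝ) → ℝ
  f_smooth : ContDiff ℝ ((⊤ : ℕ∞) : WithTop ℕ∞) f
  f_bdd : ∀ k : ℕ, ∃ C : ℝ, ∀ x, ‖iteratedFDeriv ℝ k f x‖ ≤ C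
  h : Fin n → ℝ → ℝ
  I : Fin n → WienerSpace 𝓛 → ℝ
  I_int : ∀ j, IsWienerIntegral PW (h j) (I j)
  G : JumpSpace 𝓛 → ℝ
  G_mem : MemLp G 2 (jumpLaw 𝓛)

namespace SmoothTerm

variable {𝓛 : LevyData} {PW : Measure (WienerSpace 𝓛)}

def val (F : SmoothTerm PW) (ω : Space 𝓛) : ℝ := F.f (fun j => F.I j ω.1) * F.G ω.2

/-- `∑_j ∂_j f(…) h_j(r) G`. -/
def deriv (F : SmoothTerm PW) (r : ℝ) (ω : Space 𝓛) : ℝ :=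
  ∑ j, fderiv ℝ F.f (fun i => F.I i ω.1) (Pi.single j 1) * F.h j r * F.G ω.2

/-- `∑_{j,k} ∂_k ∂_j f(…) h_j(r) h_k(q) G`. -/
def deriv₂ (F : SmoothTerm PW) (r q : ℝ) (ω : Space 𝓛) : ℝ :=
  ∑ j, ∑ k, iteratedFDeriv ℝ 2 F.f (fun i => F.I i ω.1) ![Pi.single k 1, Pi.single j 1]
    * F.h j r * F.h k q * F.G ω.2

end SmoothTerm

/-- The `L²(Ω_N)`-valued smooth random variables: finite sums of smooth terms. -/
abbrev SmoothFunctional {𝓛 : LevyData} (PW : Measure (WienerSpace 𝓛)) : Type :=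
  List (SmoothTerm PW)

namespace SmoothFunctional

variable {𝓛 : LevyData} {PW : Measure (WienerSpace 𝓛)}

def val (F : SmoothFunctional PW) (ω : Space 𝓛) : ℝ := (F.map fun G => G.val ω).sum

def deriv (F : SmoothFunctional PW) (r : ℝ) (ω : Space 𝓛) : ℝ := (F.map fun G => G.deriv r ω).sum

def deriv₂ (F : SmoothFunctional PW) (r q : ℝ) (ω : Space 𝓛) : ℝ :=
  (F.map fun G => G.deriv₂ r q ω).sum

end SmoothFunctional

section Malliavin

variable {𝓛 : LevyData} (PW : Measure (WienerSpace 𝓛))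

/-- `F` lies in the domain `𝔻^W_{1,2}(L²(Ω_N))` of the closure of the derivative, and `DF`
(as a function of the time `r` and of `ω`) is a version of `D^W F`. -/
def IsMalliavinDeriv (F : Space 𝓛 → ℝ) (DF : ℝ → Space 𝓛 → ℝ) : Prop :=
  MemLp F 2 (prob PW) ∧
  MemLp (fun z : ℝ × Space 𝓛 => DF z.1 z.2) 2 ((leb 𝓛).prod (prob PW)) ∧
  ∃ S : ℕ → SmoothFunctional PW,
    Tendsto (fun k => eLpNorm (fun ω => SmoothFunctional.val (S k) ω - F ω) 2 (prob PW))
      atTop (𝓝 0) ∧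
    Tendsto (fun k => eLpNorm (fun z : ℝ × Space 𝓛 =>
        SmoothFunctional.deriv (S k) z.1 z.2 - DF z.1 z.2) 2 ((leb 𝓛).prod (prob PW)))
      atTop (𝓝 0)

/-- `F ∈ 𝔻^W_{2,2}(L²(Ω_N))`, with `D^W F = DF` and `D^{W,2} F = D2F`. -/
def IsMalliavinDeriv₂ (F : Space 𝓛 → ℝ) (DF : ℝ → Space 𝓛 → ℝ)
    (D2F : ℝ → ℝ → Space 𝓛 → ℝ) : Prop :=
  MemLp F 2 (prob PW) ∧
  MemLp (fun z : ℝ × Space 𝓛 => DF z.1 z.2) 2 ((leb 𝓛).prod (prob PW)) ∧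
  MemLp (fun z : ℝ × ℝ × Space 𝓛 => D2F z.1 z.2.1 z.2.2) 2
    ((leb 𝓛).prod ((leb 𝓛).prod (prob PW))) ∧
  ∃ S : ℕ → SmoothFunctional PW,
    Tendsto (fun k => eLpNorm (fun ω => SmoothFunctional.val (S k) ω - F ω) 2 (prob PW))
      atTop (𝓝 0) ∧
    Tendsto (fun k => eLpNorm (fun z : ℝ × Space 𝓛 =>
        SmoothFunctional.deriv (S k) z.1 z.2 - DF z.1 z.2) 2 ((leb 𝓛).prod (prob PW)))
      atTop (𝓝 0) ∧
    Tendsto (fun k => eLpNorm (fun z : ℝ × ℝ × Space 𝓛 =>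
        SmoothFunctional.deriv₂ (S k) z.1 z.2.1 z.2.2 - D2F z.1 z.2.1 z.2.2) 2
        ((leb 𝓛).prod ((leb 𝓛).prod (prob PW))))
      atTop (𝓝 0)

/-- `‖F‖_∞ + ‖ |DF|_{L²([0,T])} ‖_∞`, for a version `DF` of the derivative of `F`. -/
def norm₁ (F : Space 𝓛 → ℝ) (DF : ℝ → Space 𝓛 → ℝ) : ℝ≥0∞ :=
  eLpNorm F ∞ (prob PW) + essSup (fun ω => eLpNorm (fun r => DF r ω) 2 (leb 𝓛)) (prob PW)

/-- `‖F‖_∞ + ‖ |DF|_{L²([0,T])} ‖_∞ + ‖ |D²F|_{L²([0,T]²)} ‖_∞`. -/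
def norm₂ (F : Space 𝓛 → ℝ) (DF : ℝ → Space 𝓛 → ℝ) (D2F : ℝ → ℝ → Space 𝓛 → ℝ) : ℝ≥0∞ :=
  norm₁ PW F DF + essSup (fun ω => eLpNorm (fun z : ℝ × ℝ => D2F z.1 z.2 ω) 2
    ((leb 𝓛).prod (leb 𝓛))) (prob PW)

/-- `F ∈ 𝔻^W_{1,∞}`. -/
def MemD₁ (F : Space 𝓛 → ℝ) : Prop :=
  ∃ DF : ℝ → Space 𝓛 → ℝ, IsMalliavinDeriv PW F DF ∧ norm₁ PW F DF < ∞

/-- `Du s r ω` is a jointly measurable version of `(D^W_r u_s)(ω)`, for almost every `s`. -/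
def IsDerivProcess (u : ℝ → Space 𝓛 → ℝ) (Du : ℝ → ℝ → Space 𝓛 → ℝ) : Prop :=
  Measurable (fun z : ℝ × ℝ × Space 𝓛 => Du z.1 z.2.1 z.2.2) ∧
  ∀ᵐ s ∂(leb 𝓛), IsMalliavinDeriv PW (u s) (Du s)

/-- The (measurable) process `u` belongs to `L^q([0,T], 𝔻^W_{1,∞})`. -/
def MemLpD₁ (q : ℝ) (u : ℝ → Space 𝓛 → ℝ) : Prop :=
  Measurable (fun z : ℝ × Space 𝓛 => u z.1 z.2) ∧
  ∃ Du : ℝ → ℝ → Space 𝓛 → ℝ, IsDerivProcess PW u Du ∧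
    ∫⁻ s, norm₁ PW (u s) (Du s) ^ q ∂(leb 𝓛) < ∞

/-- The (measurable) process `u` belongs to `L^q([0,T], 𝔻^W_{2,∞})`. -/
def MemLpD₂ (q : ℝ) (u : ℝ → Space 𝓛 → ℝ) : Prop :=
  Measurable (fun z : ℝ × Space 𝓛 => u z.1 z.2) ∧
  ∃ (Du : ℝ → ℝ → Space 𝓛 → ℝ) (D2u : ℝ → ℝ → ℝ → Space 𝓛 → ℝ),
    Measurable (fun z : ℝ × ℝ × Space 𝓛 => Du z.1 z.2.1 z.2.2) ∧
    Measurable (fun z : ℝ × ℝ × ℝ × Space 𝓛 => D2u z.1 z.2.1 z.2.2.1 z.2.2.2) ∧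
    (∀ᵐ s ∂(leb 𝓛), IsMalliavinDeriv₂ PW (u s) (Du s) (D2u s)) ∧
    ∫⁻ s, norm₂ PW (u s) (Du s) (D2u s) ^ q ∂(leb 𝓛) < ∞

/-- `u ∈ Dom δ^W`, and `I` is a version of the Skorohod integral `δ^W(u) = ∫_0^T u_r δW_r`,
defined as the adjoint of the derivative. -/
def IsSkorohodIntegral (u : ℝ → Space 𝓛 → ℝ) (I : Space 𝓛 → ℝ) : Prop :=
  MemLp (fun z : ℝ × Space 𝓛 => u z.1 z.2) 2 ((leb 𝓛).prod (prob PW)) ∧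
  MemLp I 2 (prob PW) ∧
  ∀ (F : Space 𝓛 → ℝ) (DF : ℝ → Space 𝓛 → ℝ), IsMalliavinDeriv PW F DF →
    ∫ ω, ∫ r, u r ω * DF r ω ∂(leb 𝓛) ∂(prob PW) = ∫ ω, I ω * F ω ∂(prob PW)

/-! ### Anticipative Girsanov transformations -/

/-- `A_{s,t} : Ω → Ω_W`, `0 ≤ s ≤ t ≤ T`, is the family of absolutely continuous transformations
that solves `(A_{s,t} ω)_u = ω'_u - ∫_{s ∧ u}^{t ∧ u} a_r(A_{r,t} ω, ω'') dr`. -/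
structure IsGirsanovFlow (a : ℝ → Space 𝓛 → ℝ) (A : ℝ → ℝ → Space 𝓛 → WienerSpace 𝓛) :
    Prop where
  measurable : ∀ t ∈ Icc 0 𝓛.T, Measurable (fun z : ℝ × Space 𝓛 => A z.1 t z.2)
  absCont : ∀ t ∈ Icc 0 𝓛.T, ∀ s ∈ Icc 0 t, ∀ᵐ ω'' ∂(jumpLaw 𝓛),
    PW.map (fun ω' => A s t (ω', ω'')) ≪ PW
  eqn : ∀ t ∈ Icc 0 𝓛.T, ∀ᵐ ω ∂(prob PW),
    IntervalIntegrable (fun r => a r (A r t ω, ω.2)) volume 0 t ∧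
    ∀ s ∈ Icc 0 t, ∀ u : Icc (0 : ℝ) 𝓛.T,
      (A s t ω).eval u =
        ω.1.eval u - ∫ r in (min s (u : ℝ))..(min t (u : ℝ)), a r (A r t ω, ω.2)

/-- The process `r ↦ a_r(A_{r,t}) 1_{(s,t]}(r)`. -/
def shifted (a : ℝ → Space 𝓛 → ℝ) (A : ℝ → ℝ → Space 𝓛 → WienerSpace 𝓛) (s t r : ℝ)
    (ω : Space 𝓛) : ℝ :=
  (Ioc s t).indicator (fun r => a r (A r t ω, ω.2)) r

/-- `L` is a version of the Girsanov density
`L_{s,t} = exp {∫_s^t a_r(A_{r,t}) δW_r - ½ ∫_s^t a_r(A_{r,t})² dr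
  - ∫_s^t ∫_r^t (D_u a_r)(A_{r,t}) D_r[a_u(A_{u,t})] du dr}`. -/
def IsGirsanovDensity (a : ℝ → Space 𝓛 → ℝ) (A : ℝ → ℝ → Space 𝓛 → WienerSpace 𝓛) (s t : ℝ)
    (L : Space 𝓛 → ℝ) : Prop :=
  ∃ (I : Space 𝓛 → ℝ) (Da DaA : ℝ → ℝ → Space 𝓛 → ℝ),
    IsSkorohodIntegral PW (shifted a A s t) I ∧
    IsDerivProcess PW a Da ∧
    IsDerivProcess PW (shifted a A s t) DaA ∧
    L =ᵐ[prob PW] fun ω => Real.exp (I ω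
      - (1 / 2) * ∫ r in s..t, a r (A r t ω, ω.2) ^ 2
      - ∫ r in s..t, ∫ u in r..t, Da r u (A r t ω, ω.2) * DaA u r ω)

/-! ### Hypotheses on the coefficients -/

/-- Regularity of the coefficients. Here `v s y ω` stands for `v_{s-}(y, ω)`. -/
structure CoeffRegularity (X₀ : Space 𝓛 → ℝ) (a b : ℝ → Space 𝓛 → ℝ)
    (v : ℝ → ℝ → Space 𝓛 → ℝ) : Prop where
  X₀_mem : MemD₁ PW X₀
  b_mem : MemLpD₁ PW 1 b
  v_measurable : Measurable (fun z : ℝ × ℝ × Space 𝓛 => v z.1 z.2.1 z.2.2)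
  v_mem : ∀ y : ℝ, y ≠ 0 → MemLpD₁ PW 1 (fun s => v s y)
  a_mem : ∃ p : ℝ, 2 < p ∧ MemLpD₂ PW 2 a ∧ MemLpD₁ PW (2 * p) a

end Malliavin

/-- Domination of the jump coefficient by `g ∈ L¹(ν) ∩ L²(ν)` with `g(y) → 0` as `y → 0`. -/
def JumpDomination {𝓛 : LevyData} (v : ℝ → ℝ → Space 𝓛 → ℝ) : Prop :=
  ∃ g : ℝ → ℝ, (∀ y, y ≠ 0 → 0 ≤ g y) ∧ MemLp g 1 𝓛.ν ∧ MemLp g 2 𝓛.ν ∧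
    (∀ s ∈ Icc 0 𝓛.T, ∀ y, y ≠ 0 → ∀ ω, |v s y ω| ≤ g y) ∧
    Tendsto g (𝓝[≠] 0) (𝓝 0)

/-! ### The two processes -/

section Processes

variable {𝓛 : LevyData}

/-- The factor `1 + v_{s-}(y, A_{s,t}) ΔN(s,y)`. -/
def jumpFactor (A : ℝ → ℝ → Space 𝓛 → WienerSpace 𝓛) (v : ℝ → ℝ → Space 𝓛 → ℝ) (t : ℝ)
    (ω : Space 𝓛) (s y : ℝ) : ℝ :=
  1 + v s y (A s t ω, ω.2) * jumpAt ω.2 s y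

/-- With `J` a set of jump sizes,
`X₀(A_{0,t}) exp{∫_0^t b_s(A_{s,t}) ds} L ∏_{s ≤ t, y ∈ J} [1 + v_{s-}(y, A_{s,t}) ΔN(s,y)]
  exp{-∫_0^t ∫_J v_{s-}(y, A_{s,t}) ν(dy) ds}`, the product being the unconditional one. -/
def solutionWith (X₀ : Space 𝓛 → ℝ) (b : ℝ → Space 𝓛 → ℝ) (v : ℝ → ℝ → Space 𝓛 → ℝ)
    (A : ℝ → ℝ → Space 𝓛 → WienerSpace 𝓛) (L : Space 𝓛 → ℝ) (J : Set ℝ) (t : ℝ)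
    (ω : Space 𝓛) : ℝ :=
  X₀ (A 0 t ω, ω.2) * Real.exp (∫ s in (0 : ℝ)..t, b s (A s t ω, ω.2)) * L ω
    * (∏' z : (Icc 0 t ×ˢ J : Set (ℝ × ℝ)), jumpFactor A v t ω z.1.1 z.1.2)
    * Real.exp (-∫ s in (0 : ℝ)..t, ∫ y in J, v s y (A s t ω, ω.2) ∂𝓛.ν)

/-- `X^ε_t`: only jumps of size larger than `ε` are kept. -/
def truncatedSolution (X₀ : Space 𝓛 → ℝ) (b : ℝ → Space 𝓛 → ℝ) (v : ℝ → ℝ → Space 𝓛 → ℝ)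
    (A : ℝ → ℝ → Space 𝓛 → WienerSpace 𝓛) (L : Space 𝓛 → ℝ) (ε t : ℝ) (ω : Space 𝓛) : ℝ :=
  solutionWith X₀ b v A L {y | ε < |y|} t ω

/-- `X_t`: all jumps are kept. -/
def solution (X₀ : Space 𝓛 → ℝ) (b : ℝ → Space 𝓛 → ℝ) (v : ℝ → ℝ → Space 𝓛 → ℝ)
    (A : ℝ → ℝ → Space 𝓛 → WienerSpace 𝓛) (L : Space 𝓛 → ℝ) (t : ℝ) (ω : Space 𝓛) : ℝ :=
  solutionWith X₀ b v A L {y | y ≠ 0} t ω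

end Processes

end LevySDE

end

/-!
`X^ε_t` and `X_t` share the factor `X₀(A_{0,t}) exp{∫ b_s(A_{s,t}) ds} L_{0,t}`, so only the jump
product and the compensator depend on `ε`.

* Compensator: `|v| ≤ g` with `g ∈ L¹(ν)`, and the sets `{|y| > ε}` increase to `{y ≠ 0}`, so
  dominated convergence applies twice (`tendsto_iterated_integral_gt`).
* Jump product: by Campbell's formula on each shell (`lintegral_shellSum`) the expectation of the
  sum of `g(y)` over all jumps is `T ∫ g dν < ∞`, hence that sum is almost surely finite
  (`ae_lintegral_poissonMeasure_lt_top`). The product of the factors `1 + v ΔN` therefore converges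
  unconditionally. A truncated product is a finite subproduct, because only finitely many shells
  meet `{|y| > ε}` (`finite_jumps_gt`), and these subproducts exhaust all jumps as `ε ↓ 0`
  (`tendsto_tprod_gt`).
* Integrability of `s ↦ b_s(A_{s,t})`: absolute continuity of `A_{s,t}` on almost every fibre
  carries the bound `|b_s| ≤ ‖b_s‖_∞` over to `b_s(A_{s,t})` (`IsGirsanovFlow.ae_comp`), and
  `s ↦ ‖b_s‖_∞` is integrable (`IsGirsanovFlow.ae_intervalIntegrable`).
-/

namespace LevySDE

/-! ### The jumps of the canonical Lévy process -/

lemma lt_abs_of_mem_shell {e : ℕ → ℝ} {n : ℕ} {x : ℝ} (hx : x ∈ shell e n) : e n < |x| := by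
  cases n with
  | zero => exact hx
  | succ n => exact hx.1

lemma abs_le_of_mem_shell {e : ℕ → ℝ} (he : Antitone e) {m n : ℕ} (hmn : m < n) {x : ℝ}
    (hx : x ∈ shell e n) : |x| ≤ e m := by
  cases n with
  | zero => omega
  | succ n => exact hx.2.trans (he (by omega))

lemma pairwise_disjoint_shell {e : ℕ → ℝ} (he : Antitone e) :
    Pairwise (Function.onFun Disjoint (shell e)) := by
  have key {m n : ℕ} (hmn : m < n) : Disjoint (shell e m) (shell e n) :=
    Set.disjoint_left.2 fun _ hm hn =>
      ((lt_abs_of_mem_shell hm).trans_le (abs_le_of_mem_shell he hmn hn)).false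
  intro m n hmn
  rcases hmn.lt_or_gt with h | h
  · exact key h
  · exact (key h).symm

lemma iUnion_shell (𝓛 : LevyData) : ⋃ n, shell 𝓛.e n = {0}ᶜ := by
  ext x
  simp only [mem_iUnion, mem_compl_iff, mem_singleton_iff]
  constructor
  · rintro ⟨n, hn⟩ rfl
    have := (𝓛.e_pos n).trans (lt_abs_of_mem_shell hn)
    simp at this
  · intro hx
    have hex : ∃ n, 𝓛.e n < |x| :=
      (𝓛.e_tendsto.eventually (gt_mem_nhds (abs_pos.2 hx))).exists
    classical
    refine ⟨Nat.find hex, ?_⟩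
    have hlt := Nat.find_spec hex
    rcases h : Nat.find hex with _ | n
    · rw [h] at hlt
      exact hlt
    · rw [h] at hlt
      exact ⟨hlt, not_lt.1 (Nat.find_min hex (by omega))⟩

instance (𝓛 : LevyData) : SigmaFinite 𝓛.ν := by
  refine ⟨⟨fun n => {0} ∪ ⋃ k ∈ Finset.range n, shell 𝓛.e k, fun _ => trivial, fun n => ?_, ?_⟩⟩
  · refine (measure_union_le _ _).trans_lt ?_
    rw [𝓛.ν_zero, zero_add]
    exact (measure_biUnion_finset_le _ _).trans_lt
      (ENNReal.sum_lt_top.2 fun k _ => shell_lt_top 𝓛 k)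
  · refine eq_univ_of_forall fun x => ?_
    by_cases hx : x = 0
    · exact mem_iUnion.2 ⟨0, Or.inl hx⟩
    · obtain ⟨k, hk⟩ := mem_iUnion.1 ((iUnion_shell 𝓛).symm ▸ hx : x ∈ ⋃ n, shell 𝓛.e n)
      exact mem_iUnion.2 ⟨k + 1, Or.inr (mem_biUnion (by simp) hk)⟩

/-- Only finitely many jumps are larger than a given `ε > 0`: they all lie in the finitely many
shells outside `[-ε, ε]`. -/
lemma finite_jumps_gt {𝓛 : LevyData} (ω : JumpSpace 𝓛) {ε : ℝ} (hε : 0 < ε) :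
    {z : ℝ × ℝ | ε < |z.2| ∧ jumpAt ω z.1 z.2 ≠ 0}.Finite := by
  obtain ⟨m, hm⟩ := (𝓛.e_tendsto.eventually (gt_mem_nhds hε)).exists
  let pt (n : ℕ) (l : Fin (ω n).1) : ℝ × ℝ := ((((ω n).2 l).1 : ℝ), (((ω n).2 l).2 : ℝ))
  refine ((Finset.range (m + 1)).finite_toSet.biUnion
    fun n _ => Set.finite_range (pt n)).subset ?_
  rintro ⟨s, y⟩ ⟨hy, hj⟩
  have hne : poissonMeasure ω {(s, y)} ≠ 0 := fun h => hj (by simp [jumpAt, h])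
  rw [poissonMeasure, Measure.sum_apply _ (measurableSet_singleton _), Ne,
    ENNReal.tsum_eq_zero, not_forall] at hne
  obtain ⟨n, hn⟩ := hne
  obtain ⟨l, hl⟩ : ∃ l, pt n l = (s, y) := by
    by_contra! hne
    refine hn ?_
    rw [Measure.finsetSum_apply]
    refine Finset.sum_eq_zero fun l _ => ?_
    rw [Measure.dirac_apply' _ (measurableSet_singleton _)]
    exact indicator_of_notMem (s := {(s, y)}) (hne l) 1
  have hyn : y ∈ shell 𝓛.e n := by
    have h : y = (pt n l).2 := by rw [hl]
    rw [h]
    exact ((ω n).2 l).2.2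
  refine mem_biUnion (x := n) ?_ ⟨l, hl⟩
  simp only [Finset.coe_range, mem_Iio]
  by_contra! hmn
  linarith [abs_le_of_mem_shell 𝓛.e_anti.antitone (show m < n by omega) hyn]

lemma measurable_sigma_mk (𝓛 : LevyData) (n k : ℕ) :
    Measurable fun x : Fin k → Icc (0 : ℝ) 𝓛.T × shell 𝓛.e n => (⟨k, x⟩ : ShellSpace 𝓛 n) :=
  fun _ hs => (MeasurableSpace.measurableSet_iInf.1 hs) k

/-- The sum of `G` over the jumps in the `n`-th shell. -/
noncomputable def shellSum {𝓛 : LevyData} (G : ℝ → ℝ≥0∞) (n : ℕ) (x : ShellSpace 𝓛 n) : ℝ≥0∞ :=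
  ∑ l : Fin x.1, G (x.2 l).2

lemma measurable_shellSum {𝓛 : LevyData} {G : ℝ → ℝ≥0∞} (hG : Measurable G) (n : ℕ) :
    Measurable (shellSum (𝓛 := 𝓛) G n) := by
  refine fun s hs => MeasurableSpace.measurableSet_iInf.2 fun k => ?_
  have : Measurable fun x : Fin k → Icc (0 : ℝ) 𝓛.T × shell 𝓛.e n => ∑ l, G (x l).2 := by
    fun_prop
  exact this hs

lemma volume_comap_Icc_univ (𝓛 : LevyData) :
    ((volume : Measure ℝ).comap (Subtype.val : Icc (0 : ℝ) 𝓛.T → ℝ)) univ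
      = ENNReal.ofReal 𝓛.T := by
  rw [comap_subtype_coe_apply measurableSet_Icc, image_univ, Subtype.range_coe]
  simp

/-- The total masses of the pieces of `P⁽ⁿ⁾` sum to one. -/
lemma tsum_shell_weights (𝓛 : LevyData) (n : ℕ) :
    ∑' k : ℕ, ENNReal.ofReal (Real.exp (-((𝓛.ν (shell 𝓛.e n)).toReal * 𝓛.T)))
        * (𝓛.ν (shell 𝓛.e n) ^ k / (k.factorial : ℝ≥0∞)) * ENNReal.ofReal 𝓛.T ^ k = 1 := by
  have : IsFiniteMeasure ((volume : Measure ℝ).comap (Subtype.val : Icc (0 : ℝ) 𝓛.T → ℝ)) :=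
    ⟨by rw [volume_comap_Icc_univ]; exact ENNReal.ofReal_lt_top⟩
  have h := measure_univ (μ := shellMeasure 𝓛 n)
  rw [shellMeasure, Measure.sum_apply _ MeasurableSet.univ] at h
  rw [← h]
  refine tsum_congr fun k => ?_
  rw [Measure.smul_apply, Measure.map_apply (measurable_sigma_mk 𝓛 n k) MeasurableSet.univ,
    preimage_univ, Measure.pi_univ]
  simp [Measure.prod_apply, volume_comap_Icc_univ]

/-- Campbell's formula on one shell: conditionally on the number of points, these are independent
with law proportional to `ℓ ⊗ ν`, and their expected number is `λ_n T`. -/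
lemma lintegral_shellSum {𝓛 : LevyData} {G : ℝ → ℝ≥0∞} (hG : Measurable G) (n : ℕ) :
    ∫⁻ x, shellSum G n x ∂shellMeasure 𝓛 n
      = ENNReal.ofReal 𝓛.T * ∫⁻ y in shell 𝓛.e n, G y ∂𝓛.ν := by
  have : IsFiniteMeasure
      ((volume : Measure ℝ).comap (Subtype.val : Icc (0 : ℝ) 𝓛.T → ℝ)) :=
    ⟨by rw [volume_comap_Icc_univ]; exact ENNReal.ofReal_lt_top⟩
  set lam := 𝓛.ν (shell 𝓛.e n) with hlam
  set τ := ENNReal.ofReal 𝓛.T with hτ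
  set c : ℕ → ℝ≥0∞ := fun k =>
    ENNReal.ofReal (Real.exp (-(lam.toReal * 𝓛.T))) * (lam ^ k / (k.factorial : ℝ≥0∞)) with hc
  set μ := ((volume : Measure ℝ).comap (Subtype.val : Icc (0 : ℝ) 𝓛.T → ℝ)).prod (shellLaw 𝓛 n)
    with hμ
  set q := ∫⁻ y, G y ∂shellLaw 𝓛 n with hq
  have hlam0 : lam ≠ 0 := (𝓛.shell_pos n).ne'
  have hlamt : lam ≠ ∞ := (shell_lt_top 𝓛 n).ne
  have hμ1 : μ univ = τ := by
    rw [hμ, ← univ_prod_univ, Measure.prod_prod, volume_comap_Icc_univ, measure_univ, mul_one]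
  have hμG : ∫⁻ z, G z.2 ∂μ = τ * q := by
    rw [hμ, lintegral_prod _ (by fun_prop)]
    simp [volume_comap_Icc_univ, ← hq, ← hτ, mul_comm]
  have hpi (k : ℕ) (l : Fin k) :
      ∫⁻ x, G (x l).2 ∂(Measure.pi fun _ : Fin k => μ) = τ ^ k * q := by
    have h := Measure.pi_map_eval (fun _ : Fin k => μ) l
    have hm : Measurable fun z : Icc (0 : ℝ) 𝓛.T × shell 𝓛.e n => G z.2 := by fun_prop
    rw [← lintegral_map (g := fun x : Fin k → Icc (0 : ℝ) 𝓛.T × shell 𝓛.e n => x l) hm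
      (measurable_pi_apply l)]
    have h' : Measure.map (fun x : Fin k → Icc (0 : ℝ) 𝓛.T × shell 𝓛.e n => x l)
        (Measure.pi fun _ : Fin k => μ) = τ ^ (k - 1) • μ := by
      refine h.trans ?_
      simp [hμ1]
    rw [h', lintegral_smul_measure, hμG, smul_eq_mul, ← mul_assoc, ← pow_succ]
    congr 2
    have := l.pos
    omega
  -- The factor `k` cancels against `k!`, which shifts the series of weights by one index.
  have hstep (k : ℕ) : c (k + 1) * (((k + 1 : ℕ) : ℝ≥0∞) * (τ ^ (k + 1) * q))
      = c k * τ ^ k * (lam * τ * q) := by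
    have hk : ((k + 1 : ℕ) : ℝ≥0∞) ≠ 0 := by simp
    have hk' : ((k + 1 : ℕ) : ℝ≥0∞) ≠ ∞ := ENNReal.natCast_ne_top _
    simp only [hc]
    rw [Nat.factorial_succ, Nat.cast_mul, div_eq_mul_inv, div_eq_mul_inv,
      ENNReal.mul_inv (Or.inl hk) (Or.inl hk')]
    calc _ = (((k + 1 : ℕ) : ℝ≥0∞) * ((k + 1 : ℕ) : ℝ≥0∞)⁻¹)
          * (ENNReal.ofReal (Real.exp (-(lam.toReal * 𝓛.T)))
            * (lam ^ k * (k.factorial : ℝ≥0∞)⁻¹) * τ ^ k * (lam * τ * q)) := by ring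
      _ = _ := by rw [ENNReal.mul_inv_cancel hk hk', one_mul]
  have hlq : lam * q = ∫⁻ y in shell 𝓛.e n, G y ∂𝓛.ν := by
    rw [hq, shellLaw, lintegral_smul_measure, smul_eq_mul, ← mul_assoc, ← hlam,
      ENNReal.mul_inv_cancel hlam0 hlamt, one_mul,
      ← lintegral_subtype_comap (measurableSet_shell _ _)]
  have hterm (k : ℕ) : ∫⁻ x, shellSum G n x ∂(c k • (Measure.pi fun _ : Fin k => μ).map
      fun x => (⟨k, x⟩ : ShellSpace 𝓛 n)) = c k * ((k : ℝ≥0∞) * (τ ^ k * q)) := by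
    rw [lintegral_smul_measure, lintegral_map (measurable_shellSum hG n)
      (measurable_sigma_mk 𝓛 n k), smul_eq_mul]
    congr 1
    simp only [shellSum]
    refine (lintegral_finsetSum Finset.univ fun l _ => ?_).trans ?_
    · fun_prop
    · simp [hpi]
  calc ∫⁻ x, shellSum G n x ∂shellMeasure 𝓛 n
      = ∑' k, c k * ((k : ℝ≥0∞) * (τ ^ k * q)) := by
        rw [shellMeasure, lintegral_sum_measure]
        exact tsum_congr hterm
    _ = ∑' k, c k * τ ^ k * (lam * τ * q) := by
        rw [tsum_eq_zero_add' ENNReal.summable]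
        simp only [hstep, Nat.cast_zero, zero_mul, mul_zero, zero_add]
    _ = τ * ∫⁻ y in shell 𝓛.e n, G y ∂𝓛.ν := by
        rw [ENNReal.tsum_mul_right, tsum_shell_weights, one_mul, ← hlq]
        ring

lemma lintegral_poissonMeasure {𝓛 : LevyData} (G : ℝ → ℝ≥0∞) (ω : JumpSpace 𝓛) :
    ∫⁻ z, G z.2 ∂poissonMeasure ω = ∑' n, shellSum G n (ω n) := by
  simp [poissonMeasure, lintegral_sum_measure, lintegral_finsetSum_measure, shellSum]

/-- If `G` is `ν`-integrable, then almost surely it is summable over the jumps. By Campbell's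
formula the expected sum is `T ∫ G dν`. -/
lemma ae_lintegral_poissonMeasure_lt_top {𝓛 : LevyData} {G : ℝ → ℝ≥0∞} (hG : Measurable G)
    (hint : ∫⁻ y, G y ∂𝓛.ν ≠ ∞) :
    ∀ᵐ ω ∂jumpLaw 𝓛, ∫⁻ z, G z.2 ∂poissonMeasure ω < ∞ := by
  simp_rw [lintegral_poissonMeasure]
  have hm (n : ℕ) : Measurable fun ω : JumpSpace 𝓛 => shellSum G n (ω n) :=
    (measurable_shellSum hG n).comp (measurable_pi_apply n)
  refine ae_lt_top (Measurable.tsum hm) (ne_of_lt ?_)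
  rw [lintegral_tsum fun n => (hm n).aemeasurable]
  have h (n : ℕ) : ∫⁻ ω, shellSum G n (ω n) ∂jumpLaw 𝓛
      = ENNReal.ofReal 𝓛.T * ∫⁻ y in shell 𝓛.e n, G y ∂𝓛.ν :=
    ((measurePreserving_eval_infinitePi (shellMeasure 𝓛) n).lintegral_comp
      (measurable_shellSum hG n)).trans (lintegral_shellSum hG n)
  simp_rw [h]
  rw [ENNReal.tsum_mul_left, ← lintegral_iUnion (measurableSet_shell _)
    (pairwise_disjoint_shell 𝓛.e_anti.antitone)]
  exact ENNReal.mul_lt_top ENNReal.ofReal_lt_top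
    ((setLIntegral_le_lintegral _ _).trans_lt hint.lt_top)

/-- An integrable function is dominated everywhere by a measurable one that is still integrable.
This allows evaluation at the jumps, where an almost everywhere bound would be of no use. -/
lemma exists_measurable_enorm_le {α : Type*} [MeasurableSpace α] {μ : Measure α} {g : α → ℝ}
    (hg : Integrable g μ) :
    ∃ G : α → ℝ≥0∞, Measurable G ∧ (∀ x, ‖g x‖ₑ ≤ G x) ∧ ∫⁻ x, G x ∂μ ≠ ∞ := by
  obtain ⟨f, hf, hgf⟩ := hg.1
  obtain ⟨N, hN, hNm, hN0⟩ := exists_measurable_superset_of_null (ae_iff.1 hgf)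
  refine ⟨fun x => ‖f x‖ₑ + N.indicator (fun _ => ∞) x,
    hf.measurable.enorm.add (measurable_const.indicator hNm), fun x => ?_, ?_⟩
  · by_cases hx : x ∈ N
    · simp [hx]
    · have : g x = f x := by
        by_contra h
        exact hx (hN h)
      simp [this]
  · rw [lintegral_add_left hf.measurable.enorm, lintegral_indicator_const hNm, hN0, mul_zero,
      add_zero]
    exact (hg.congr hgf).2.ne

lemma tsum_mul_measure_singleton_le {α : Type*} [MeasurableSpace α] [MeasurableSingletonClass α]
    (μ : Measure α) (f : α → ℝ≥0∞) : ∑' x, f x * μ {x} ≤ ∫⁻ x, f x ∂μ := by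
  rw [ENNReal.tsum_eq_iSup_sum]
  refine iSup_le fun s => ?_
  rw [← lintegral_finset]
  exact setLIntegral_le_lintegral _ _

/-! ### Composition with the Girsanov flow -/

section Flow

variable {𝓛 : LevyData} {PW : Measure (WienerSpace 𝓛)}

/-- A property that holds almost surely still holds almost surely after the transformation
`ω ↦ (A_{s,t} ω, ω'')`, because the latter is absolutely continuous fibre by fibre. -/
lemma IsGirsanovFlow.ae_comp [IsProbabilityMeasure PW] {a : ℝ → Space 𝓛 → ℝ}
    {A : ℝ → ℝ → Space 𝓛 → WienerSpace 𝓛} (hA : IsGirsanovFlow PW a A) {s t : ℝ}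
    (ht : t ∈ Icc 0 𝓛.T) (hs : s ∈ Icc 0 t) {p : Space 𝓛 → Prop} (hp : ∀ᵐ ω ∂prob PW, p ω) :
    ∀ᵐ ω ∂prob PW, p (A s t ω, ω.2) := by
  have : IsProbabilityMeasure (jumpLaw 𝓛) := by unfold jumpLaw; infer_instance
  have hAm : Measurable (A s t) := (hA.measurable t ht).comp measurable_prodMk_left
  obtain ⟨N, hpN, hNm, hN0⟩ := exists_measurable_superset_of_null (ae_iff.1 hp)
  suffices h : ∀ᵐ ω ∂prob PW, (A s t ω, ω.2) ∉ N from
    h.mono fun ω hω => by_contra fun hn => hω (hpN hn)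
  have hNm' : MeasurableSet {ω : Space 𝓛 | (A s t ω, ω.2) ∉ N} :=
    ((hAm.prodMk measurable_snd) hNm).compl
  have hN : ∀ᵐ ω ∂prob PW, ω ∉ N := measure_eq_zero_iff_ae_notMem.1 hN0
  rw [prob, Measure.ae_prod_iff_ae_ae hNm.compl, Measure.ae_ae_comm hNm.compl] at hN
  rw [prob, Measure.ae_prod_iff_ae_ae hNm', Measure.ae_ae_comm hNm']
  filter_upwards [hN, hA.absCont t ht s hs] with ω'' h1 h2
  exact ae_of_ae_map (hAm.comp measurable_prodMk_right).aemeasurable (h2.ae_le h1)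

lemma measurable_eLpNorm_top {α β : Type*} [MeasurableSpace α] [MeasurableSpace β]
    {μ : Measure β} [SFinite μ] {u : α → β → ℝ} (hu : Measurable fun z : α × β => u z.1 z.2) :
    Measurable fun s => eLpNorm (u s) ∞ μ := by
  simp only [eLpNorm_exponent_top]
  refine measurable_of_Ioi fun c => ?_
  have h : (fun s => eLpNormEssSup (u s) μ) ⁻¹' Ioi c
      = {s | 0 < μ (Prod.mk s ⁻¹' {z : α × β | c < ‖u z.1 z.2‖ₑ})} := by
    ext s
    have : (∀ᵐ x ∂μ, ‖u s x‖ₑ ≤ c) ↔ eLpNormEssSup (u s) μ ≤ c :=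
      ⟨fun h => essSup_le_of_ae_le c h,
        fun h => ae_le_eLpNormEssSup.mono fun _ hx => hx.trans h⟩
    rw [mem_preimage, mem_Ioi, mem_ofPred_eq, ← not_le, ← this, ae_iff, pos_iff_ne_zero]
    simp [preimage]
  rw [h]
  exact measurableSet_lt measurable_const
    (measurable_measure_prodMk_left (measurableSet_lt measurable_const hu.enorm))

/-- If `u ∈ L¹([0,T], 𝔻^W_{1,∞})`, then `s ↦ u_s(A_{s,t})` is almost surely integrable: it is
dominated by `‖u_s‖_∞`. -/
lemma IsGirsanovFlow.ae_intervalIntegrable [IsProbabilityMeasure PW] {a u : ℝ → Space 𝓛 → ℝ}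
    {A : ℝ → ℝ → Space 𝓛 → WienerSpace 𝓛} (hA : IsGirsanovFlow PW a A) {t : ℝ}
    (ht : t ∈ Icc 0 𝓛.T) (hu : MemLpD₁ PW 1 u) :
    ∀ᵐ ω ∂prob PW, IntervalIntegrable (fun s => u s (A s t ω, ω.2)) volume 0 t := by
  have : IsProbabilityMeasure (jumpLaw 𝓛) := by unfold jumpLaw; infer_instance
  have : SFinite (prob PW) := by unfold prob; infer_instance
  obtain ⟨hum, Du, -, hint⟩ := hu
  have hcomp : Measurable fun z : ℝ × Space 𝓛 => u z.1 (A z.1 t z.2, z.2.2) :=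
    hum.comp (measurable_fst.prodMk ((hA.measurable t ht).prodMk measurable_snd.snd))
  have hN := measurable_eLpNorm_top (μ := prob PW) hum
  have hfin : ∫⁻ s in Icc 0 t, eLpNorm (u s) ∞ (prob PW) < ∞ := by
    refine lt_of_le_of_lt ?_ hint
    refine (lintegral_mono_set (Icc_subset_Icc_right ht.2)).trans (lintegral_mono fun s => ?_)
    simp [norm₁]
  have hle : ∀ᵐ s ∂volume.restrict (Icc 0 t), ∀ᵐ ω ∂prob PW,
      ‖u s (A s t ω, ω.2)‖ₑ ≤ eLpNorm (u s) ∞ (prob PW) := by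
    filter_upwards [ae_restrict_mem measurableSet_Icc] with s hs
    refine hA.ae_comp ht hs (p := fun ω => ‖u s ω‖ₑ ≤ eLpNorm (u s) ∞ (prob PW)) ?_
    rw [eLpNorm_exponent_top]
    exact ae_le_eLpNormEssSup
  have hset : MeasurableSet {z : ℝ × Space 𝓛 |
      ‖u z.1 (A z.1 t z.2, z.2.2)‖ₑ ≤ eLpNorm (u z.1) ∞ (prob PW)} :=
    measurableSet_le hcomp.enorm (hN.comp measurable_fst)
  filter_upwards [(Measure.ae_ae_comm hset).1 hle] with ω hω
  rw [intervalIntegrable_iff_integrableOn_Icc_of_le ht.1]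
  exact ⟨(hcomp.comp measurable_prodMk_right).aestronglyMeasurable,
    (lintegral_mono_ae hω).trans_lt hfin⟩

end Flow

/-! ### Limits as the truncation level tends to zero -/

/-- Let finitely many factors with `ε < |y|` differ from one, for every `ε > 0`. Then an
unconditionally convergent product is the limit of its truncations. -/
lemma tendsto_tprod_gt {S : Set ℝ} {f : ℝ × ℝ → ℝ}
    (hf : Multipliable fun z : (S ×ˢ {y | y ≠ 0} : Set (ℝ × ℝ)) => f z)
    (hfin : ∀ ε > 0, {z : ℝ × ℝ | z.1 ∈ S ∧ ε < |z.2| ∧ f z ≠ 1}.Finite) :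
    Tendsto (fun ε : ℝ => ∏' z : (S ×ˢ {y | ε < |y|} : Set (ℝ × ℝ)), f z) (𝓝[>] 0)
      (𝓝 (∏' z : (S ×ˢ {y | y ≠ 0} : Set (ℝ × ℝ)), f z)) := by
  have hprod := hasProd_subtype_iff_mulIndicator.1 hf.hasProd
  set F := (S ×ˢ {y : ℝ | y ≠ 0} : Set (ℝ × ℝ)).mulIndicator f with hF
  rw [HasProd, SummationFilter.unconditional_filter] at hprod
  intro U hU
  obtain ⟨s, hs⟩ := mem_atTop_sets.1 (hprod hU)
  -- Once `ε` is below all nonzero `|y|` occurring in `s`, the truncated product runs over a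
  -- finite set that contains `s` up to factors equal to one.
  have hsmall : ∀ᶠ ε : ℝ in 𝓝[>] 0, ∀ z ∈ s, z.2 ≠ 0 → ε < |z.2| := by
    refine s.eventually_all.2 fun z _ => ?_
    by_cases hz : z.2 = 0
    · simp [hz]
    · filter_upwards [nhdsWithin_le_nhds (gt_mem_nhds (abs_pos.2 hz))] with ε hε _ using hε
  rw [mem_map]
  filter_upwards [hsmall, self_mem_nhdsWithin] with ε hε hε0
  classical
  set K := (hfin ε hε0).toFinset with hK
  have hmem (z : ℝ × ℝ) : z ∈ K ↔ z.1 ∈ S ∧ ε < |z.2| ∧ f z ≠ 1 := by simp [hK]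
  have hKF : ∀ z ∈ K, F z = f z := fun z hz =>
    mulIndicator_of_mem (show z ∈ S ×ˢ {y : ℝ | y ≠ 0} from
      ⟨((hmem z).1 hz).1, abs_pos.1 (lt_trans hε0 ((hmem z).1 hz).2.1)⟩) f
  have heq : ∏' z : (S ×ˢ {y | ε < |y|} : Set (ℝ × ℝ)), f z = ∏ z ∈ K ∪ s, F z := by
    rw [tprod_subtype (S ×ˢ {y | ε < |y|} : Set (ℝ × ℝ)) f, tprod_eq_prod (s := K)]
    · refine (Finset.prod_congr rfl fun z hz => ?_).trans
        (Finset.prod_subset Finset.subset_union_left fun z hz hzK => ?_)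
      · rw [hKF z hz]
        exact mulIndicator_of_mem
          (show z ∈ S ×ˢ {y : ℝ | ε < |y|} from ⟨((hmem z).1 hz).1, ((hmem z).1 hz).2.1⟩) f
      · have hzs : z ∈ s := (Finset.mem_union.1 hz).resolve_left hzK
        by_contra hne
        have hzF := mem_of_mulIndicator_ne_one hne
        rw [hF, mulIndicator_of_mem hzF] at hne
        exact hzK ((hmem z).2 ⟨hzF.1, hε z hzs hzF.2, hne⟩)
    · intro z hz
      by_contra hne
      have hzF := mem_of_mulIndicator_ne_one hne
      rw [mulIndicator_of_mem hzF] at hne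
      exact hz ((hmem z).2 ⟨hzF.1, hzF.2, hne⟩)
  rw [mem_preimage, heq]
  exact hs _ Finset.subset_union_right

lemma tendsto_integral_gt {μ : Measure ℝ} {f g : ℝ → ℝ} (hf : AEStronglyMeasurable f μ)
    (hg : Integrable g μ) (hfg : ∀ y, y ≠ 0 → |f y| ≤ g y) :
    Tendsto (fun ε : ℝ => ∫ y in {y | ε < |y|}, f y ∂μ) (𝓝[>] 0)
      (𝓝 (∫ y in {y | y ≠ 0}, f y ∂μ)) := by
  have hm (ε : ℝ) : MeasurableSet {y : ℝ | ε < |y|} := measurableSet_lt measurable_const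
    measurable_norm
  have hm0 : MeasurableSet {y : ℝ | y ≠ 0} := (measurableSet_singleton (0 : ℝ)).compl
  simp_rw [← integral_indicator (hm _), ← integral_indicator hm0]
  refine tendsto_integral_filter_of_dominated_convergence (fun y => |g y|) ?_ ?_ hg.abs ?_
  · exact Eventually.of_forall fun ε => hf.indicator (hm ε)
  · filter_upwards [self_mem_nhdsWithin] with ε hε
    refine Eventually.of_forall fun y => ?_
    by_cases hy : ε < |y|
    · rw [indicator_of_mem (show y ∈ {y : ℝ | ε < |y|} from hy), Real.norm_eq_abs]
      exact (hfg y (abs_pos.1 (lt_trans hε hy))).trans (le_abs_self _)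
    · rw [indicator_of_notMem (show y ∉ {y : ℝ | ε < |y|} from hy)]
      simp
  · refine Eventually.of_forall fun y => ?_
    by_cases hy : y = 0
    · refine tendsto_const_nhds.congr' ?_
      filter_upwards [self_mem_nhdsWithin] with ε hε
      have : ¬ ε < |y| := by simpa [hy] using le_of_lt hε
      rw [indicator_of_notMem (show y ∉ {y : ℝ | y ≠ 0} by simpa using hy),
        indicator_of_notMem (show y ∉ {y : ℝ | ε < |y|} from this)]
    · refine tendsto_const_nhds.congr' ?_
      filter_upwards [nhdsWithin_le_nhds (gt_mem_nhds (abs_pos.2 hy))] with ε hε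
      rw [indicator_of_mem (show y ∈ {y : ℝ | y ≠ 0} from hy),
        indicator_of_mem (show y ∈ {y : ℝ | ε < |y|} from hε)]

lemma tendsto_iterated_integral_gt {μ : Measure ℝ} [SFinite μ] {w : ℝ → ℝ → ℝ} {g : ℝ → ℝ}
    {t : ℝ} (ht : 0 ≤ t) (hw : Measurable fun z : ℝ × ℝ => w z.1 z.2) (hg : Integrable g μ)
    (hwg : ∀ s ∈ Icc 0 t, ∀ y, y ≠ 0 → |w s y| ≤ g y) :
    Tendsto (fun ε : ℝ => ∫ s in (0 : ℝ)..t, ∫ y in {y | ε < |y|}, w s y ∂μ) (𝓝[>] 0)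
      (𝓝 (∫ s in (0 : ℝ)..t, ∫ y in {y | y ≠ 0}, w s y ∂μ)) := by
  have hsub {s : ℝ} (hs : s ∈ uIoc 0 t) : s ∈ Icc 0 t := by
    rw [uIoc_of_le ht] at hs
    exact Ioc_subset_Icc_self hs
  refine intervalIntegral.tendsto_integral_filter_of_dominated_convergence
    (fun _ => ∫ y, |g y| ∂μ) ?_ ?_ intervalIntegrable_const ?_
  · exact Eventually.of_forall fun ε =>
      (StronglyMeasurable.integral_prod_right hw.stronglyMeasurable).aestronglyMeasurable
  · filter_upwards [self_mem_nhdsWithin] with ε hε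
    refine Eventually.of_forall fun s hs => ?_
    have hm : MeasurableSet {y : ℝ | ε < |y|} := measurableSet_lt measurable_const measurable_norm
    refine (norm_integral_le_of_norm_le hg.abs.integrableOn ?_).trans
      (setIntegral_le_integral hg.abs (Eventually.of_forall fun y => abs_nonneg _))
    filter_upwards [ae_restrict_mem hm] with y hy
    exact (hwg s (hsub hs) y (abs_pos.1 (lt_trans hε hy))).trans (le_abs_self _)
  · exact Eventually.of_forall fun s hs =>
      tendsto_integral_gt (hw.comp measurable_prodMk_left).aestronglyMeasurable hg
        (hwg s (hsub hs))

end LevySDE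

/-! ### Convergence of the truncated solutions -/

open LevySDE in
theorem proposition3p1 (𝓛 : LevyData)
    (PW : Measure (WienerSpace 𝓛)) (hPW : IsWienerMeasure PW)
    (X₀ : Space 𝓛 → ℝ) (a b : ℝ → Space 𝓛 → ℝ) (v : ℝ → ℝ → Space 𝓛 → ℝ)
    (hreg : CoeffRegularity PW X₀ a b v) (hdom : JumpDomination v)
    (A : ℝ → ℝ → Space 𝓛 → WienerSpace 𝓛) (hA : IsGirsanovFlow PW a A)
    (t : ℝ) (ht : t ∈ Icc 0 𝓛.T)
    (L : Space 𝓛 → ℝ) (hL : IsGirsanovDensity PW a A 0 t L) :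
    ∀ᵐ ω ∂(prob PW),
      IntervalIntegrable (fun s => b s (A s t ω, ω.2)) volume 0 t ∧
      Integrable (fun z : ℝ × ℝ => v z.1 z.2 (A z.1 t ω, ω.2))
        ((volume.restrict (Icc 0 t)).prod 𝓛.ν) ∧
      (∀ ε : ℝ, 0 < ε →
        {z : ℝ × ℝ | z.1 ∈ Icc 0 t ∧ ε < |z.2| ∧ jumpAt ω.2 z.1 z.2 ≠ 0}.Finite) ∧
      Multipliable (fun z : (Icc 0 t ×ˢ {y | y ≠ 0} : Set (ℝ × ℝ)) =>
        jumpFactor A v t ω z.1.1 z.1.2) ∧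
      Tendsto (fun ε => truncatedSolution X₀ b v A L ε t ω) (𝓝[>] 0)
        (𝓝 (solution X₀ b v A L t ω)) := by
  have hprobW : IsProbabilityMeasure PW := hPW.gaussian.isProbabilityMeasure
  have hprobN : IsProbabilityMeasure (jumpLaw 𝓛) := by unfold jumpLaw; infer_instance
  obtain ⟨g, -, hg1, -, hvg, -⟩ := hdom
  have hg : Integrable g 𝓛.ν := memLp_one_iff_integrable.1 hg1
  obtain ⟨G, hGm, hgG, hGint⟩ := exists_measurable_enorm_le hg
  have hjumps : ∀ᵐ ω ∂prob PW, ∫⁻ z, G z.2 ∂LevySDE.poissonMeasure ω.2 < ∞ :=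
    Measure.quasiMeasurePreserving_snd.ae (ae_lintegral_poissonMeasure_lt_top hGm hGint)
  filter_upwards [hA.ae_intervalIntegrable ht hreg.b_mem, hjumps] with ω hb hω
  have hvm : Measurable fun z : ℝ × ℝ => v z.1 z.2 (A z.1 t ω, ω.2) := by
    have h := (hA.measurable t ht).comp
      (measurable_fst.prodMk measurable_const : Measurable fun z : ℝ × ℝ => (z.1, ω))
    exact hreg.v_measurable.comp
      (measurable_fst.prodMk (measurable_snd.prodMk (h.prodMk measurable_const)))
  have hvg' : ∀ s ∈ Icc 0 t, ∀ y, y ≠ 0 → |v s y (A s t ω, ω.2)| ≤ g y :=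
    fun s hs y hy => hvg s ⟨hs.1, hs.2.trans ht.2⟩ y hy _
  have hfin : ∀ ε : ℝ, 0 < ε →
      {z : ℝ × ℝ | z.1 ∈ Icc 0 t ∧ ε < |z.2| ∧ jumpAt ω.2 z.1 z.2 ≠ 0}.Finite :=
    fun ε hε => (finite_jumps_gt ω.2 hε).subset fun z hz => hz.2
  have hmul : Multipliable fun z : (Icc 0 t ×ˢ {y | y ≠ 0} : Set (ℝ × ℝ)) =>
      jumpFactor A v t ω z.1.1 z.1.2 := by
    -- `|v ΔN| ≤ G(y) N({(s, y)})`, and the sum of the right-hand sides is at most `∫ G dN`.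
    refine multipliable_one_add_of_summable ?_
    have hsum : ∑' z : (Icc 0 t ×ˢ {y | y ≠ 0} : Set (ℝ × ℝ)),
        G z.1.2 * LevySDE.poissonMeasure ω.2 {z.1} < ∞ :=
      (ENNReal.tsum_comp_le_tsum_of_injective Subtype.val_injective
        fun z : ℝ × ℝ => G z.2 * LevySDE.poissonMeasure ω.2 {z}).trans_lt
        ((tsum_mul_measure_singleton_le _ fun z : ℝ × ℝ => G z.2).trans_lt hω)
    refine Summable.of_nonneg_of_le (fun z => norm_nonneg _) (fun z => ?_)
      (ENNReal.summable_toReal hsum.ne)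
    rw [← toReal_enorm]
    refine ENNReal.toReal_mono (ENNReal.ne_top_of_tsum_ne_top hsum.ne z) ?_
    rw [enorm_mul]
    refine mul_le_mul' ((enorm_le_iff_norm_le.2 ?_).trans (hgG _)) ?_
    · exact (hvg' _ z.2.1 _ z.2.2).trans (le_abs_self _)
    · rw [jumpAt, Real.enorm_eq_ofReal ENNReal.toReal_nonneg]
      exact ENNReal.ofReal_toReal_le
  refine ⟨hb, ?_, hfin, hmul, ?_⟩
  · have hbound : Integrable (fun z : ℝ × ℝ => g z.2)
        ((volume.restrict (Icc 0 t)).prod 𝓛.ν) := hg.comp_snd _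
    refine hbound.mono' hvm.aestronglyMeasurable ?_
    have hs : ∀ᵐ z ∂((volume.restrict (Icc 0 t)).prod 𝓛.ν), z.1 ∈ Icc 0 t :=
      Measure.quasiMeasurePreserving_fst.ae (ae_restrict_mem measurableSet_Icc)
    have hy : ∀ᵐ z ∂((volume.restrict (Icc 0 t)).prod 𝓛.ν), z.2 ≠ 0 :=
      Measure.quasiMeasurePreserving_snd.ae (measure_eq_zero_iff_ae_notMem.1 𝓛.ν_zero)
    filter_upwards [hs, hy] with z h1 h2 using hvg' _ h1 _ h2
  · have hlim := tendsto_tprod_gt (f := fun z => jumpFactor A v t ω z.1 z.2) hmul fun ε hε =>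
      (hfin ε hε).subset fun z hz => ⟨hz.1, hz.2.1, fun h => hz.2.2 (by simp [jumpFactor, h])⟩
    exact (hlim.const_mul _).mul
      ((Real.continuous_exp.tendsto _).comp
        (tendsto_iterated_integral_gt ht.1 hvm hg hvg').neg)
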